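/- Let $\alpha<1$ be a constant. For each $p$ let $0\le c=c(p)\le p$ (for instance a constant), and let $G$ be an Erdős–Rényi random graph on $p$ labelled vertices in which each of the $\binom p2$ pairs is an edge independently with probability $c/p$. For every graph $g$ on $\{1,\dots,p\}$ let $J_g$ be a symmetric positive definite $p\times p$ matrix such that, for $i\ne j$, $J_g(i,j)=0$ if and only if $\{i,j\}$ is not an edge of $g$. Given $G=g$, let $\mathbf X^n=(\mathbf X_1,\dots,\mathbf X_n)$, $n=n(p)$, be i.i.d. samples from the zero-mean Gaussian law $\mathcal N(0,J_g^{-1})$. Assume that, with probability tending to $1$ as $p\to\infty$, $J_G$ has unit diagonal and is $\alpha$-walk-summable, that is, $\|\overline{R}_G\|\le\alpha$ in spectral norm, where $\overline R_G$ is the entrywise absolute value of the partial correlation matrix $R_G(i,j)=-J_G(i,j)/\sqrt{J_G(i,i)J_G(j,j)}$ for $i\neq j$, $R_G(i,i)=0$. Let $D=D(p)\ge1$ be integers, put $\beta=D/\binom p2$, and suppose $\beta\le\tfrac12$ for all sufficiently large $p$. For graphs $g,g'$ on the same vertices let $d(g,g')=|E(g)\,\triangle\,E(g')|$ be the edit distance,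 and let $H_b(x)=-x\log_2x-(1-x)\log_2(1-x)$ be the binary entropy function. If there are (measurable) estimators $\widehat G=\widehat G(\mathbf X^n)$ for which the probability of error $$P_e^{(p)}=P\big(d(G,\widehat G(\mathbf X^n))>D\big)$$ (over both $G$ and $\mathbf X^n$) tends to $0$ as $p\to\infty$, then $$n\;\ge\;\frac{2}{p\,\log_2\!\left[2\pi e\left(\frac1{1-\alpha}+1\right)\right]}\binom p2\left[H_b\!\left(\frac cp\right)-H_b(\beta)\right]$$ for all $p$ sufficiently large. -/

import Mathlib

open MeasureTheory ProbabilityTheory Filter Topology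

noncomputable section

namespace GGMConverse

/-- The binary entropy function in bits,
`H_b(x) = -x log₂ x - (1 - x) log₂ (1 - x)` (with `0 log₂ 0 = 0`). -/
def binEntropyBits (x : ℝ) : ℝ := Real.binEntropy x / Real.log 2

/-- The law of the Erdős–Rényi random graph on `p` labelled vertices in which every pair of
vertices is joined independently with probability `c / p` (used for `0 ≤ c ≤ p`, where the
projection to the unit interval does nothing). -/
def erdosRenyi (p : ℕ) (c : ℝ) : Measure (SimpleGraph (Fin p)) :=
  SimpleGraph.binomialRandom (Fin p) (Set.projIcc (0 : ℝ) 1 zero_le_one (c / p))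

/-- The edit distance of two graphs on the same vertices: the number of edges that belong to
exactly one of them. -/
def editDist {p : ℕ} (G G' : SimpleGraph (Fin p)) : ℕ :=
  (symmDiff G.edgeSet G'.edgeSet).ncard

/-- `J` is the potential (precision) matrix of a Gaussian graphical model on `G`: it is symmetric
positive definite, and its off-diagonal sparsity pattern is that of `G`. -/
def IsPotentialMatrix {p : ℕ} (G : SimpleGraph (Fin p)) (J : Matrix (Fin p) (Fin p) ℝ) : Prop :=
  J.PosDef ∧ ∀ i j, i ≠ j → (J i j = 0 ↔ ¬ G.Adj i j)

/-- The matrix of partial correlation coefficients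
`R(i,j) = -J(i,j) / √(J(i,i) J(j,j))` for `i ≠ j`, and `R(i,i) = 0`. -/
def partialCorrelation {p : ℕ} (J : Matrix (Fin p) (Fin p) ℝ) : Matrix (Fin p) (Fin p) ℝ :=
  Matrix.of fun i j => if i = j then 0 else -J i j / Real.sqrt (J i i * J j j)

/-- `α`-walk-summability: the spectral norm (the operator norm for the Euclidean norm) of the
entrywise absolute value of the partial correlation matrix is at most `α`. -/
def WalkSummable {p : ℕ} (α : ℝ) (J : Matrix (Fin p) (Fin p) ℝ) : Prop :=
  ‖Matrix.toEuclideanCLM (𝕜 := ℝ) ((partialCorrelation J).map fun x => |x|)‖ ≤ α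

/-- The law of `n` independent samples of the centred Gaussian vector with precision matrix `J`,
that is, with covariance matrix `J⁻¹`. -/
def sampleLaw {p : ℕ} (n : ℕ) (J : Matrix (Fin p) (Fin p) ℝ) :
    Measure (Fin n → EuclideanSpace ℝ (Fin p)) :=
  Measure.pi fun _ => multivariateGaussian 0 J⁻¹

/-- The joint law of `(G, X₁, …, Xₙ)`: the graph `G` is an Erdős–Rényi graph, and, given `G`, the
samples are independent centred Gaussian vectors with precision matrix `J G`. -/
def jointLaw (p n : ℕ) (c : ℝ) (J : SimpleGraph (Fin p) → Matrix (Fin p) (Fin p) ℝ) :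
    Measure (SimpleGraph (Fin p) × (Fin n → EuclideanSpace ℝ (Fin p))) :=
  ∑ G : SimpleGraph (Fin p), erdosRenyi p c {G} • (Measure.dirac G).prod (sampleLaw n (J G))

/-- The probability, under the joint law of the graph and the samples, that the estimated graph is
at edit distance more than `D` from the true graph. -/
def errorProb (p n : ℕ) (c : ℝ) (J : SimpleGraph (Fin p) → Matrix (Fin p) (Fin p) ℝ)
    (Ghat : (Fin n → EuclideanSpace ℝ (Fin p)) → SimpleGraph (Fin p)) (D : ℕ) : ENNReal :=
  jointLaw p n c J {z | D < editDist z.1 (Ghat z.2)}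

end GGMConverse

end

/-! The samples are removed by a change of measure. If `J` has unit diagonal and is
`α`-walk-summable, then `J ≥ (1 - α) I` and `det J ≤ 1`, so the law of a sample is at most `(1 -
α)^(-p/2)` times `N(0, (1 - α)⁻¹ I)` (`multivariateGaussian_le`). Hence the law of `n` samples is at
most `(1 - α)^(-pn/2) Q`, with `Q` independent of the graph.

Write `N = p.choose 2`, `q = c / p`, and let `h` be the entropy in nats. By Chebyshev, outside
probability `N / s²` a graph has mass at most `exp (-N h(q) + s)`. Under `Q` the estimate ignores
the true graph, so summing the success probabilities over all graphs gives at most the volume `exp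
(N h(β))` of a Hamming ball. Together this is `one_le_errorProb_add`. If the claimed bound on `n`
failed for some `n ≥ 1`, the factor `2πe (1/(1-α) + 1)`, larger than the needed `1/(1-α)`, would
leave room in the exponent for `s` proportional to `p`, forcing an error probability bounded away
from `0`.

For `n = 0` there is no such room. The estimate is then a fixed graph, and anti-concentration of its
distance to `G` gives error at least `1/12` (`one_div_twelve_le_errorProb_of_no_samples`). -/

namespace GGMConverse
open scoped RealInnerProductSpace

/-! ### Gaussian densities and domination of measures -/

section Gaussian

variable {E : Type*} [NormedAddCommGroup E] [InnerProductSpace ℝ E] [FiniteDimensional ℝ E]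
  [MeasurableSpace E] [BorelSpace E]

/-- The standard Gaussian measure has density `(2π)^(-d/2) exp (-‖x‖² / 2)`. -/
theorem stdGaussian_eq_withDensity :
    stdGaussian E = (volume : Measure E).withDensity fun x =>
      ENNReal.ofReal (((2 * Real.pi) ^ (Module.finrank ℝ E / 2 : ℝ))⁻¹ *
        Real.exp (-‖x‖ ^ 2 / 2)) := by
  set k : ℝ := ((2 * Real.pi) ^ (Module.finrank ℝ E / 2 : ℝ))⁻¹ with hk
  have hk0 : 0 < k := by positivity
  have hint : Integrable (fun x : E => k * Real.exp (-‖x‖ ^ 2 / 2)) := by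
    have h := (GaussianFourier.integrable_cexp_neg_mul_sq_norm_add (V := E) (b := 1 / 2)
      (by norm_num) 0 0).norm.const_mul k
    refine h.congr (ae_of_all _ fun x => ?_)
    simp only [Complex.norm_exp]
    congr 2
    norm_num [← Complex.ofReal_pow]
    ring
  have : IsFiniteMeasure ((volume : Measure E).withDensity fun x =>
      ENNReal.ofReal (k * Real.exp (-‖x‖ ^ 2 / 2))) :=
    isFiniteMeasure_withDensity_ofReal hint.2
  apply Measure.ext_of_charFun
  ext t
  rw [charFun_stdGaussian, charFun_apply,
    integral_withDensity_eq_integral_toReal_smul (by fun_prop) (by simp)]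
  have h1 : ∀ x : E, (ENNReal.ofReal (k * Real.exp (-‖x‖ ^ 2 / 2))).toReal •
      Complex.exp (⟪x, t⟫ * Complex.I) =
      k * Complex.exp (-(1 / 2 : ℂ) * ‖x‖ ^ 2 + Complex.I * ⟪t, x⟫) := by
    intro x
    rw [ENNReal.toReal_ofReal (by positivity), Complex.real_smul, Complex.exp_add,
      real_inner_comm]
    push_cast
    rw [mul_assoc]
    congr 3 <;> ring_nf
  simp_rw [h1]
  rw [integral_const_mul, GaussianFourier.integral_cexp_neg_mul_sq_norm_add (by norm_num)]
  have h2 : (k : ℂ) * (Real.pi / (1 / 2 : ℂ)) ^ (Module.finrank ℝ E / 2 : ℂ) = 1 := by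
    have : (Real.pi / (1 / 2 : ℂ)) ^ (Module.finrank ℝ E / 2 : ℂ)
        = (((2 * Real.pi) ^ (Module.finrank ℝ E / 2 : ℝ) : ℝ) : ℂ) := by
      rw [Complex.ofReal_cpow (by positivity)]
      push_cast
      congr 1
      ring
    rw [this, ← Complex.ofReal_mul, hk, inv_mul_cancel₀ (by positivity)]
    simp
  rw [← mul_assoc, h2, one_mul, Complex.I_sq]
  congr 1
  ring

/-- The image of the standard Gaussian measure under an invertible contraction has a bounded
density with respect to the standard Gaussian measure. -/
theorem map_stdGaussian_le (T : E →L[ℝ] E) (hdet : LinearMap.det (T : E →ₗ[ℝ] E) ≠ 0)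
    (hT : ∀ x, ‖T x‖ ≤ ‖x‖) :
    (stdGaussian E).map T ≤
      ENNReal.ofReal |(LinearMap.det (T : E →ₗ[ℝ] E))⁻¹| • stdGaussian E := by
  rw [stdGaussian_eq_withDensity]
  set k : ℝ := ((2 * Real.pi) ^ (Module.finrank ℝ E / 2 : ℝ))⁻¹ with hk
  have hk0 : 0 < k := by positivity
  set f : E → ENNReal := fun x => ENNReal.ofReal (k * Real.exp (-‖x‖ ^ 2 / 2)) with hf
  have hfm : Measurable f := by fun_prop
  refine Measure.le_iff.2 fun s hs => ?_
  rw [Measure.map_apply (by fun_prop) hs, Measure.smul_apply, smul_eq_mul,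
    withDensity_apply _ (T.continuous.measurable hs), withDensity_apply _ hs]
  -- The density decreases with the norm, so a contraction can only raise it; the rest is the linear
  -- change of variables.
  calc ∫⁻ x in T ⁻¹' s, f x ≤ ∫⁻ x in T ⁻¹' s, f (T x) := by
        refine lintegral_mono fun x => ENNReal.ofReal_le_ofReal ?_
        gcongr
        exact hT x
    _ = ∫⁻ y in s, f y ∂((volume : Measure E).map T) := by
        rw [setLIntegral_map hs hfm (by fun_prop)]
    _ = _ := by
        have h := Measure.map_linearMap_addHaar_eq_smul_addHaar (volume : Measure E) hdet
        rw [ContinuousLinearMap.coe_coe] at h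
        rw [h, Measure.restrict_smul, lintegral_smul_measure, smul_eq_mul]

end Gaussian

/-- The product outer measure is the largest one bounded on boxes by the product of the side
measures, so comparing boxes is enough. -/
theorem pi_le_smul_pi {ι X : Type*} [Fintype ι] [MeasurableSpace X] (μ ν : Measure X)
    [IsFiniteMeasure μ] [IsFiniteMeasure ν] (K : ENNReal) (hK : K ≠ ⊤) (h : μ ≤ K • ν) :
    Measure.pi (fun _ : ι => μ) ≤ K ^ Fintype.card ι • Measure.pi (fun _ : ι => ν) := by
  have : IsFiniteMeasure (K • ν) := Measure.smul_finite ν hK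
  have h1 : Measure.pi (fun _ : ι => K • ν) =
      K ^ Fintype.card ι • Measure.pi (fun _ : ι => ν) := by
    refine Measure.pi_eq fun s _ => ?_
    simp [Measure.pi_pi, Finset.prod_mul_distrib, Finset.prod_const, Finset.card_univ]
  rw [← h1]
  refine Measure.le_iff.2 fun s hs => ?_
  rw [Measure.pi_def (fun _ : ι => K • ν), toMeasure_apply _ _ hs]
  have h2 : (Measure.pi fun _ : ι => μ).toOuterMeasure ≤
      OuterMeasure.pi fun _ : ι => (K • ν).toOuterMeasure := by
    refine OuterMeasure.le_pi.2 fun t _ => ?_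
    change Measure.pi (fun _ : ι => μ) (Set.pi Set.univ t) ≤ ∏ i, (K • ν) (t i)
    rw [Measure.pi_pi]
    exact Finset.prod_le_prod' fun i _ => h (t i)
  exact h2 s

end GGMConverse

/-! ### Walk-summable precision matrices -/

namespace GGMConverse
open scoped RealInnerProductSpace MatrixOrder
open Matrix

theorem det_toEuclideanCLM {ι : Type*} [Fintype ι] [DecidableEq ι] (A : Matrix ι ι ℝ) :
    LinearMap.det (toEuclideanCLM (𝕜 := ℝ) A : EuclideanSpace ℝ ι →ₗ[ℝ] EuclideanSpace ℝ ι) =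
      A.det := by
  rw [coe_toEuclideanCLM_eq_toEuclideanLin, toEuclideanLin, toLpLin_eq_toLin,
    LinearMap.det_toLin]

/-- A positive definite matrix with unit diagonal has determinant at most one. -/
theorem det_le_one_of_diag_eq_one {ι : Type*} [Fintype ι] [DecidableEq ι] {J : Matrix ι ι ℝ}
    (hJ : J.PosDef) (hd : ∀ i, J i i = 1) : J.det ≤ 1 := by
  have h1 := hJ.isHermitian.det_eq_prod_eigenvalues
  have h2 := hJ.isHermitian.trace_eq_sum_eigenvalues
  have h3 : J.trace = Fintype.card ι := by simp [Matrix.trace, hd]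
  simp only [RCLike.ofReal_real_eq_id, id] at h1 h2
  rw [h1]
  -- AM-GM in the form `t ≤ exp (t - 1)`: the exponents sum to the trace minus the dimension, which
  -- is `0`.
  calc ∏ i, hJ.isHermitian.eigenvalues i
      ≤ ∏ i, Real.exp (hJ.isHermitian.eigenvalues i - 1) := by
        refine Finset.prod_le_prod (fun i _ => (hJ.eigenvalues_pos i).le) fun i _ => ?_
        linarith [Real.add_one_le_exp (hJ.isHermitian.eigenvalues i - 1)]
    _ = 1 := by
        rw [← Real.exp_sum, Finset.sum_sub_distrib, ← h2, h3]
        simp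

/-- Walk-summability bounds the quadratic form of a normalized potential matrix from below. -/
theorem WalkSummable.mul_norm_sq_le {p : ℕ} {α : ℝ} {J : Matrix (Fin p) (Fin p) ℝ}
    (hw : WalkSummable α J) (hd : ∀ i, J i i = 1) (x : EuclideanSpace ℝ (Fin p)) :
    (1 - α) * ‖x‖ ^ 2 ≤ x.ofLp ⬝ᵥ (J *ᵥ x.ofLp) := by
  set R := (partialCorrelation J).map fun x => |x| with hR
  set y : EuclideanSpace ℝ (Fin p) := WithLp.toLp 2 fun i => |x i| with hy
  have hyn : ‖y‖ = ‖x‖ := by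
    simp [EuclideanSpace.norm_eq, hy]
  have h1 : y.ofLp ⬝ᵥ (R *ᵥ y.ofLp) ≤ α * ‖x‖ ^ 2 := by
    rw [← inner_toEuclideanCLM]
    calc _ ≤ ‖y‖ * ‖toEuclideanCLM (𝕜 := ℝ) R y‖ := real_inner_le_norm _ _
      _ ≤ ‖y‖ * (α * ‖y‖) := by
        gcongr
        exact (ContinuousLinearMap.le_opNorm _ _).trans (by gcongr; exact hw)
      _ = α * ‖x‖ ^ 2 := by rw [hyn]; ring
  have h2 : ‖x‖ ^ 2 = ∑ i, x i * x i := by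
    rw [EuclideanSpace.real_norm_sq_eq]; simp [sq]
  -- Unit diagonal makes `J` the identity minus the partial correlations; the off-diagonal terms are
  -- bounded by their absolute values.
  have h3 : ‖x‖ ^ 2 - y.ofLp ⬝ᵥ (R *ᵥ y.ofLp) ≤ x.ofLp ⬝ᵥ (J *ᵥ x.ofLp) := by
    rw [h2]
    simp only [dotProduct, mulVec, ← Finset.sum_sub_distrib]
    refine Finset.sum_le_sum fun i _ => ?_
    have h4 : x i * x i = x i * ∑ j, (if i = j then x j else 0) := by simp
    rw [h4, Finset.mul_sum, Finset.mul_sum, Finset.mul_sum, ← Finset.sum_sub_distrib]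
    refine Finset.sum_le_sum fun j _ => ?_
    by_cases hij : i = j
    · subst hij; simp [hR, hy, partialCorrelation, hd]
    · simp only [hij, if_false, mul_zero, zero_sub, hR, hy, partialCorrelation, hd, map_apply,
        of_apply, Real.sqrt_one, mul_one, div_one, abs_neg]
      rw [neg_le]
      calc -(x i * (J i j * x j)) ≤ |x i * (J i j * x j)| := neg_le_abs _
        _ = _ := by rw [abs_mul, abs_mul]
  linarith

/-- If the precision matrix is positive definite, normalized and `α`-walk-summable, then the
centred Gaussian law is dominated by a multiple of the Gaussian law with independent components
of variance `(1 - α)⁻¹`. -/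
theorem multivariateGaussian_le {p : ℕ} {α : ℝ} (hα : α < 1) {J : Matrix (Fin p) (Fin p) ℝ}
    (hJ : J.PosDef) (hw : WalkSummable α J) (hd : ∀ i, J i i = 1) :
    multivariateGaussian 0 J⁻¹ ≤ ENNReal.ofReal (√(1 - α)⁻¹ ^ p) •
      (stdGaussian (EuclideanSpace ℝ (Fin p))).map fun x => √(1 - α)⁻¹ • x := by
  have hα' : 0 < 1 - α := by linarith
  set σ := √(1 - α)⁻¹ with hσ
  have hσ0 : 0 < σ := by positivity
  have hσ2 : σ ^ 2 = (1 - α)⁻¹ := Real.sq_sqrt (by positivity)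
  set A := CFC.sqrt J⁻¹ with hA
  have hAA : A * A = J⁻¹ := CFC.sqrt_mul_sqrt_self _ hJ.inv.posSemidef.nonneg
  have hdetJ := det_le_one_of_diag_eq_one hJ hd
  have hdetA : 1 ≤ |A.det| := by
    have h1 : A.det * A.det = (J.det)⁻¹ := by
      rw [← det_mul, hAA, det_nonsing_inv, Ring.inverse_eq_inv']
    have h2 : 1 ≤ (J.det)⁻¹ := (one_le_inv₀ hJ.det_pos).2 hdetJ
    rw [← h1] at h2
    rw [← sq_le_sq₀ zero_le_one (abs_nonneg _), sq_abs]
    nlinarith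
  -- `T = σ⁻¹ J^(-1/2)` carries the standard Gaussian to the sample law rescaled by `σ⁻¹`; it
  -- contracts because `J⁻¹ ≤ σ² I`.
  set T : EuclideanSpace ℝ (Fin p) →L[ℝ] EuclideanSpace ℝ (Fin p) :=
    toEuclideanCLM (𝕜 := ℝ) (σ⁻¹ • A) with hT
  have hdetT : LinearMap.det (T : EuclideanSpace ℝ (Fin p) →ₗ[ℝ] EuclideanSpace ℝ (Fin p)) =
      σ⁻¹ ^ p * A.det := by
    rw [hT, det_toEuclideanCLM, det_smul, Fintype.card_fin]
  have hTx : ∀ x, T x = σ⁻¹ • toEuclideanCLM (𝕜 := ℝ) A x := by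
    intro x; rw [hT, map_smul]; rfl
  have hcontr : ∀ x, ‖T x‖ ≤ ‖x‖ := by
    intro x
    have hself : IsSelfAdjoint (toEuclideanCLM (𝕜 := ℝ) A) :=
      (CFC.sqrt_nonneg J⁻¹).isSelfAdjoint.map _
    have h1 : ‖toEuclideanCLM (𝕜 := ℝ) A x‖ ^ 2 = ⟪x, toEuclideanCLM (𝕜 := ℝ) J⁻¹ x⟫ := by
      rw [← real_inner_self_eq_norm_sq, ← hAA, map_mul, mul_apply_eq_comp]
      conv_lhs => rw [← ContinuousLinearMap.adjoint_inner_right, hself.adjoint_eq]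
    set y := toEuclideanCLM (𝕜 := ℝ) J⁻¹ x with hy
    have h2 : toEuclideanCLM (𝕜 := ℝ) J y = x := by
      rw [hy, ← mul_apply_eq_comp, ← map_mul,
        mul_nonsing_inv _ hJ.det_pos.ne'.isUnit, map_one, one_apply_eq_self]
    have h3 : (1 - α) * ‖y‖ ^ 2 ≤ ⟪x, y⟫ := by
      have := hw.mul_norm_sq_le hd y
      rwa [← inner_toEuclideanCLM, h2, real_inner_comm] at this
    have h4 : ⟪x, y⟫ ≤ ‖x‖ * ‖y‖ := real_inner_le_norm _ _
    -- Expanding the square avoids dividing by `‖y‖`, which may vanish.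
    have h5 : (1 - α) * ⟪x, y⟫ ≤ ‖x‖ ^ 2 := by
      nlinarith [sq_nonneg (‖x‖ - (1 - α) * ‖y‖)]
    have h6 : ‖T x‖ ^ 2 ≤ ‖x‖ ^ 2 := by
      rw [hTx, norm_smul, mul_pow, h1, Real.norm_eq_abs, sq_abs, inv_pow, hσ2, inv_inv]
      exact h5
    exact (sq_le_sq₀ (norm_nonneg _) (norm_nonneg _)).1 h6
  have hdetT0 : LinearMap.det (T : EuclideanSpace ℝ (Fin p) →ₗ[ℝ] EuclideanSpace ℝ (Fin p)) ≠ 0 := by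
    rw [hdetT]
    have : A.det ≠ 0 := fun h => by simp [h] at hdetA; linarith
    positivity
  have hle := map_stdGaussian_le T hdetT0 hcontr
  have hmap : multivariateGaussian 0 J⁻¹ =
      ((stdGaussian (EuclideanSpace ℝ (Fin p))).map T).map fun x => σ • x := by
    rw [Measure.map_map (by fun_prop) (by fun_prop), multivariateGaussian]
    congr 1
    ext1 x
    simp [hTx, smul_smul, hσ0.ne']
    rfl
  rw [hmap]
  refine (Measure.map_mono hle (by fun_prop)).trans ?_
  rw [Measure.map_smul]
  refine Measure.le_iff.2 fun s _ => ?_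
  simp only [Measure.smul_apply, smul_eq_mul]
  gcongr
  rw [hdetT, mul_inv, abs_mul, inv_pow, inv_inv, abs_inv, abs_of_pos (by positivity)]
  exact mul_le_of_le_one_right (by positivity) (inv_le_one_of_one_le₀ hdetA)

end GGMConverse

namespace GGMConverse

/-! ### Random subsets: moments, anti-concentration, Hamming balls -/

section Bernoulli

variable {ι : Type*}

/-- The expectation of `f` at a random subset of `s` to which every element of `s` belongs
independently with probability `q`. -/
def bernoulliSum (q : ℝ) (s : Finset ι) (f : Finset ι → ℝ) : ℝ :=
  ∑ A ∈ s.powerset, q ^ A.card * (1 - q) ^ (s.card - A.card) * f A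

theorem bernoulliSum_congr {q : ℝ} {s : Finset ι} {f g : Finset ι → ℝ}
    (h : ∀ A ⊆ s, f A = g A) : bernoulliSum q s f = bernoulliSum q s g :=
  Finset.sum_congr rfl fun A hA => by rw [h A (Finset.mem_powerset.1 hA)]

theorem bernoulliSum_mono {q : ℝ} (h0 : 0 ≤ q) (h1 : q ≤ 1) {s : Finset ι}
    {f g : Finset ι → ℝ} (h : ∀ A ⊆ s, f A ≤ g A) : bernoulliSum q s f ≤ bernoulliSum q s g := by
  have : 0 ≤ 1 - q := by linarith
  refine Finset.sum_le_sum fun A hA => ?_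
  gcongr
  exact h A (Finset.mem_powerset.1 hA)

theorem bernoulliSum_add (q : ℝ) (s : Finset ι) (f g : Finset ι → ℝ) :
    bernoulliSum q s (fun A => f A + g A) = bernoulliSum q s f + bernoulliSum q s g := by
  simp [bernoulliSum, mul_add, Finset.sum_add_distrib]

theorem bernoulliSum_const_mul (q : ℝ) (s : Finset ι) (c : ℝ) (f : Finset ι → ℝ) :
    bernoulliSum q s (fun A => c * f A) = c * bernoulliSum q s f := by
  simp [bernoulliSum, Finset.mul_sum, mul_left_comm]

variable [DecidableEq ι]

theorem bernoulliSum_insert {q : ℝ} {s : Finset ι} {a : ι} (ha : a ∉ s) (f : Finset ι → ℝ) :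
    bernoulliSum q (insert a s) f =
      bernoulliSum q s fun A => (1 - q) * f A + q * f (insert a A) := by
  unfold bernoulliSum
  rw [Finset.sum_powerset_insert ha, ← Finset.sum_add_distrib]
  refine Finset.sum_congr rfl fun A hA => ?_
  have hAs := Finset.mem_powerset.1 hA
  have hle := Finset.card_le_card hAs
  rw [Finset.card_insert_of_notMem ha, Finset.card_insert_of_notMem fun h => ha (hAs h),
    Nat.add_sub_add_right, Nat.sub_add_comm hle]
  ring

/-- The centred and signed number of elements of `s` in `A`. -/
def signedCount (q : ℝ) (ε : ι → ℝ) (s A : Finset ι) : ℝ :=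
  ∑ i ∈ s, ε i * ((if i ∈ A then 1 else 0) - q)

/-- Conditioning on whether `a` is chosen gives the recursion that drives all moment computations.
-/
theorem bernoulliSum_signedCount_insert {q : ℝ} (ε : ι → ℝ) {s : Finset ι} {a : ι} (ha : a ∉ s)
    (F : ℝ → ℝ) :
    bernoulliSum q (insert a s) (fun A => F (signedCount q ε (insert a s) A)) =
      bernoulliSum q s fun A => (1 - q) * F (signedCount q ε s A - ε a * q) +
        q * F (signedCount q ε s A + ε a * (1 - q)) := by
  rw [bernoulliSum_insert ha]
  refine bernoulliSum_congr fun A hA => ?_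
  have haA : a ∉ A := fun h => ha (hA h)
  have h1 : signedCount q ε (insert a s) A = signedCount q ε s A - ε a * q := by
    simp only [signedCount, Finset.sum_insert ha, haA, if_false]; ring
  have h2 : signedCount q ε (insert a s) (insert a A) =
      signedCount q ε s A + ε a * (1 - q) := by
    have : ∀ i ∈ s, (i ∈ insert a A ↔ i ∈ A) := fun i hi => by
      rw [Finset.mem_insert, or_iff_right]; rintro rfl; exact ha hi
    simp only [signedCount, Finset.sum_insert ha, Finset.mem_insert_self, if_true]
    rw [add_comm, Finset.sum_congr rfl fun i hi => by rw [if_congr (this i hi) rfl rfl]]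
  rw [h1, h2]

theorem bernoulliSum_one (q : ℝ) (s : Finset ι) : bernoulliSum q s (fun _ => 1) = 1 := by
  induction s using Finset.induction_on with
  | empty => simp [bernoulliSum]
  | insert a s ha ih =>
    rw [bernoulliSum_insert ha]
    exact (bernoulliSum_congr fun A _ => by ring).trans ih

theorem bernoulliSum_signedCount (q : ℝ) (ε : ι → ℝ) (s : Finset ι) :
    bernoulliSum q s (fun A => signedCount q ε s A) = 0 := by
  induction s using Finset.induction_on with
  | empty => simp [bernoulliSum, signedCount]
  | insert a s ha ih =>
    rw [bernoulliSum_signedCount_insert ε ha (fun x => x), ← ih]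
    exact bernoulliSum_congr fun A _ => by ring

theorem bernoulliSum_signedCount_sq (q : ℝ) {ε : ι → ℝ} (hε : ∀ i, ε i ^ 2 = 1) (s : Finset ι) :
    bernoulliSum q s (fun A => signedCount q ε s A ^ 2) = s.card * (q * (1 - q)) := by
  induction s using Finset.induction_on with
  | empty => simp [bernoulliSum, signedCount]
  | insert a s ha ih =>
    rw [bernoulliSum_signedCount_insert ε ha (fun x => x ^ 2), Finset.card_insert_of_notMem ha]
    calc _ = bernoulliSum q s (fun A => signedCount q ε s A ^ 2 + q * (1 - q) * 1) :=
          bernoulliSum_congr fun A _ => by linear_combination (q * (1 - q)) * hε a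
      _ = _ := by
          rw [bernoulliSum_add, ih, bernoulliSum_const_mul, bernoulliSum_one]
          push_cast; ring

/-- With `v = q (1 - q)`, a new element adds `6 v · (s.card * v)` and its own fourth moment `v (1 -
3 v)`; the term linear in the old sum has mean zero. -/
theorem bernoulliSum_signedCount_pow_four_le {q : ℝ} (h0 : 0 ≤ q) (h1 : q ≤ 1) {ε : ι → ℝ}
    (hε : ∀ i, ε i ^ 2 = 1) (s : Finset ι) :
    bernoulliSum q s (fun A => signedCount q ε s A ^ 4) ≤
      3 * (s.card * (q * (1 - q))) ^ 2 + s.card * (q * (1 - q)) := by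
  induction s using Finset.induction_on with
  | empty => simp [bernoulliSum, signedCount]
  | insert a s ha ih =>
    rw [bernoulliSum_signedCount_insert ε ha (fun x => x ^ 4), Finset.card_insert_of_notMem ha]
    set v := q * (1 - q) with hv
    have hv0 : 0 ≤ v := mul_nonneg h0 (by linarith)
    have h3 : ε a ^ 3 = ε a := by linear_combination ε a * hε a
    have h4 : ε a ^ 4 = 1 := by linear_combination (ε a ^ 2 + 1) * hε a
    calc _ = bernoulliSum q s (fun A => signedCount q ε s A ^ 4 +
            (6 * v * signedCount q ε s A ^ 2 +
            (4 * ε a * (v * (1 - 2 * q)) * signedCount q ε s A + v * (1 - 3 * v) * 1))) :=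
          bernoulliSum_congr fun A _ => by
            rw [hv]
            linear_combination (6 * (q * (1 - q)) * signedCount q ε s A ^ 2) * hε a +
              4 * (q * (1 - q) * (1 - 2 * q)) * signedCount q ε s A * h3 +
              (q * (1 - q) * (1 - 3 * (q * (1 - q)))) * h4
      _ = bernoulliSum q s (fun A => signedCount q ε s A ^ 4) + 6 * v * (s.card * v) +
            v * (1 - 3 * v) := by
          simp only [bernoulliSum_add, bernoulliSum_const_mul, bernoulliSum_one,
            bernoulliSum_signedCount, bernoulliSum_signedCount_sq q hε]
          ring
      _ ≤ _ := by
          push_cast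
          nlinarith [sq_nonneg v]

/-- Anti-concentration: a sum of independent centred signed Bernoulli variables of variance at
least `1 / 2` is positive with probability at least `1 / 12`. -/
theorem one_div_twelve_le_bernoulliSum_pos {q : ℝ} (h0 : 0 ≤ q) (h1 : q ≤ 1) {ε : ι → ℝ}
    (hε : ∀ i, ε i ^ 2 = 1) {s : Finset ι} (hs : 1 / 2 ≤ s.card * (q * (1 - q))) :
    1 / 12 ≤ bernoulliSum q s fun A => if 0 < signedCount q ε s A then 1 else 0 := by
  set V := s.card * (q * (1 - q)) with hV
  have hV0 : 0 < V := by linarith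
  set σ := √V with hσ
  have hσ0 : 0 < σ := Real.sqrt_pos.2 hV0
  have hσ2 : σ ^ 2 = V := Real.sq_sqrt hV0.le
  -- A quartic minorant of the indicator, with a critical point at `5/2`. For `z ≤ 0` the cubic
  -- factor is smallest at `-z = √(10/3) ≈ 1.826`. Normalized moments `0`, `1` and at most `3 + 1/V
  -- ≤ 5` yield `1/6 - 5/60 = 1/12`.
  have key : ∀ z : ℝ, 5 / 24 * z + 1 / 6 * z ^ 2 - 1 / 60 * z ^ 4 ≤ if 0 < z then 1 else 0 := by
    intro z
    split_ifs with hz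
    · nlinarith [sq_nonneg (z ^ 2 - 25 / 4), sq_nonneg (z - 5 / 2)]
    · have hz' : 0 ≤ -z := by linarith
      have h : 0 ≤ 5 / 4 + (-z) ^ 3 / 10 - (-z) := by
        nlinarith [mul_nonneg (by linarith : 0 ≤ -z + 2 * 1.826) (sq_nonneg (-z - 1.826))]
      nlinarith [mul_nonneg hz' h]
  have h2 := bernoulliSum_signedCount_sq q hε s
  have h4 := bernoulliSum_signedCount_pow_four_le h0 h1 hε s
  rw [← hV] at h2 h4
  calc (1 / 12 : ℝ) ≤ 1 / 6 - 1 / 60 * ((3 * V ^ 2 + V) / V ^ 2) := by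
        have : (3 * V ^ 2 + V) / V ^ 2 ≤ 5 := by
          rw [div_le_iff₀ (by positivity)]; nlinarith
        linarith
    _ ≤ bernoulliSum q s (fun A => 5 / 24 * σ⁻¹ * signedCount q ε s A +
          (1 / 6 * (σ ^ 2)⁻¹ * signedCount q ε s A ^ 2 +
            -(1 / 60 * (σ ^ 4)⁻¹) * signedCount q ε s A ^ 4)) := by
        rw [bernoulliSum_add, bernoulliSum_add]
        simp only [bernoulliSum_const_mul, bernoulliSum_signedCount, h2]
        have h5 : σ ^ 4 = V ^ 2 := by rw [← hσ2]; ring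
        rw [h5, hσ2]
        have h6 : (V ^ 2)⁻¹ * bernoulliSum q s (fun A => signedCount q ε s A ^ 4) ≤
            (3 * V ^ 2 + V) / V ^ 2 := by
          rw [inv_mul_eq_div]; gcongr
        have h7 : 1 / 6 * V⁻¹ * V = 1 / 6 := by field_simp
        rw [h7]
        linarith
    _ ≤ _ := by
        refine bernoulliSum_mono h0 h1 fun A _ => ?_
        have h := key (σ⁻¹ * signedCount q ε s A)
        have hpos : 0 < σ⁻¹ * signedCount q ε s A ↔ 0 < signedCount q ε s A :=
          mul_pos_iff_of_pos_left (by positivity)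
        rw [if_congr hpos rfl rfl] at h
        refine le_trans (le_of_eq ?_) h
        field_simp
        ring

/-- Chebyshev's inequality for the number of elements of a random subset. -/
theorem bernoulliSum_lt_sq_le {q : ℝ} (h0 : 0 ≤ q) (h1 : q ≤ 1) {ε : ι → ℝ}
    (hε : ∀ i, ε i ^ 2 = 1) (s : Finset ι) {t : ℝ} (ht : 0 < t) :
    bernoulliSum q s (fun A => if t < signedCount q ε s A ^ 2 then 1 else 0) ≤
      s.card * (q * (1 - q)) / t := by
  rw [← bernoulliSum_signedCount_sq q hε, le_div_iff₀ ht, mul_comm, ← bernoulliSum_const_mul]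
  refine bernoulliSum_mono h0 h1 fun A _ => ?_
  split_ifs with h
  · linarith
  · simpa using sq_nonneg _

theorem pow_mul_pow_eq_exp_neg_binEntropy {N D : ℕ} {β : ℝ} (hβ0 : 0 < β) (hβ1 : β < 1)
    (hD : (D : ℝ) = N * β) (hDN : D ≤ N) :
    β ^ D * (1 - β) ^ (N - D) = Real.exp (-(N * Real.binEntropy β)) := by
  have : 0 < 1 - β := by linarith
  rw [← Real.exp_log (by positivity : 0 < β ^ D * (1 - β) ^ (N - D)),
    Real.log_mul (by positivity) (by positivity), Real.log_pow, Real.log_pow, Nat.cast_sub hDN,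
    Real.binEntropy, Real.log_inv, Real.log_inv, hD]
  congr 1
  ring

/-- The volume of a Hamming ball of relative radius `β ≤ 1 / 2` is at most `exp (N h(β))`. -/
theorem card_symmDiff_le_le_exp {s B : Finset ι} (hB : B ⊆ s) {D : ℕ} (hD : 1 ≤ D)
    (hβ : (D : ℝ) / s.card ≤ 1 / 2) (hs : s.Nonempty) :
    ((s.powerset.filter fun A => (symmDiff A B).card ≤ D).card : ℝ) ≤
      Real.exp (s.card * Real.binEntropy (D / s.card)) := by
  set N := s.card with hN
  set β : ℝ := D / N with hβd
  have hN0 : (0 : ℝ) < N := by exact_mod_cast hs.card_pos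
  have hD0 : (0 : ℝ) < D := by exact_mod_cast hD
  have hβ0 : 0 < β := by positivity
  have hDβ : (D : ℝ) = N * β := by rw [hβd]; field_simp
  have hDN : D ≤ N := by
    have : (D : ℝ) ≤ N := by rw [hDβ]; nlinarith
    exact_mod_cast this
  -- Symmetric difference with `B` moves the centre to the empty set.
  have hcard : (s.powerset.filter fun A => (symmDiff A B).card ≤ D).card ≤
      (s.powerset.filter fun A => A.card ≤ D).card := by
    refine Finset.card_le_card_of_injOn (fun A => symmDiff A B) ?_
      (symmDiff_left_injective B).injOn
    intro A hA
    simp only [Finset.coe_filter, Finset.mem_powerset, Set.mem_ofPred_eq] at hA ⊢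
    refine ⟨fun x hx => ?_, hA.2⟩
    rcases Finset.mem_symmDiff.1 hx with h | h
    exacts [hA.1 h.1, hB h.1]
  -- As `β ≤ 1 - β`, each set of size at most `D` has `β`-Bernoulli mass at least that of a set of
  -- size `D`; the total mass is `1`.
  have hsum : ((s.powerset.filter fun A => A.card ≤ D).card : ℝ) *
      Real.exp (-(N * Real.binEntropy β)) ≤ 1 := by
    refine le_trans ?_ (bernoulliSum_one β s).le
    rw [← pow_mul_pow_eq_exp_neg_binEntropy hβ0 (by linarith) hDβ hDN, bernoulliSum,
      ← nsmul_eq_mul, ← Finset.sum_const]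
    have h1β : 0 ≤ 1 - β := by linarith
    refine (Finset.sum_le_sum fun A hA => ?_).trans
      (Finset.sum_le_sum_of_subset_of_nonneg (Finset.filter_subset _ _) fun _ _ _ =>
        mul_nonneg (mul_nonneg (pow_nonneg hβ0.le _) (pow_nonneg h1β _)) zero_le_one)
    obtain ⟨hAs, hAD⟩ := Finset.mem_filter.1 hA
    obtain ⟨k, rfl⟩ := Nat.exists_eq_add_of_le hAD
    rw [mul_one, ← hN, show N - A.card = (N - (A.card + k)) + k by omega, pow_add, pow_add,
      mul_assoc, mul_comm (β ^ k)]
    exact mul_le_mul_of_nonneg_left (mul_le_mul_of_nonneg_left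
      (pow_le_pow_left₀ hβ0.le (by linarith) k) (pow_nonneg h1β _)) (pow_nonneg hβ0.le _)
  rw [Real.exp_neg, ← div_eq_mul_inv, div_le_one (Real.exp_pos _)] at hsum
  exact (Nat.cast_le.2 hcard).trans hsum

end Bernoulli

/-- With `t` the log-odds, `q (1 - q) = 1 / (2 + 2 cosh t)` and `2 cosh t ≥ 2 + t²`. This bounds the
variance of the log-likelihood per edge uniformly in `q`. -/
theorem mul_log_sq_le_one {q : ℝ} (h0 : 0 < q) (h1 : q < 1) :
    q * (1 - q) * (Real.log ((1 - q) / q)) ^ 2 ≤ 1 := by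
  have h1' : 0 < 1 - q := by linarith
  set t := Real.log ((1 - q) / q) with ht
  have he : Real.exp t = (1 - q) / q := Real.exp_log (by positivity)
  have he' : Real.exp (-t) = q / (1 - q) := by rw [Real.exp_neg, he, inv_div]
  have hc : 1 + t ^ 2 / 2 ≤ Real.cosh t := by
    have h := Real.cosh_sq' (t / 2)
    have h2 : Real.cosh t = Real.cosh (t / 2) ^ 2 + Real.sinh (t / 2) ^ 2 := by
      rw [← Real.cosh_two_mul]; congr 1; ring
    have h3 : (t / 2) ^ 2 ≤ Real.sinh (t / 2) ^ 2 := by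
      rw [sq_le_sq, Real.abs_sinh]
      exact Real.self_le_sinh_iff.2 (abs_nonneg _)
    rw [h2, h]
    nlinarith
  have hsum : (q * (1 - q)) * (2 + 2 * Real.cosh t) = 1 := by
    rw [Real.cosh_eq, he, he']
    field_simp
    ring
  have hv : 0 < q * (1 - q) := by positivity
  nlinarith

end GGMConverse

namespace GGMConverse

/-! ### Graphs as edge sets -/

section Graphs

variable {p : ℕ}

/-- The potential edges on the vertex set `Fin p`. -/
def potentialEdges (p : ℕ) : Finset (Sym2 (Fin p)) := Finset.univ.filter fun e => ¬ e.IsDiag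

/-- The finite set of edges of a graph. -/
noncomputable def edges (G : SimpleGraph (Fin p)) : Finset (Sym2 (Fin p)) := G.edgeSet.toFinite.toFinset

theorem card_potentialEdges (p : ℕ) : (potentialEdges p).card = p.choose 2 := by
  have h := Sym2.card_subtype_not_diag (α := Fin p)
  rw [Fintype.card_fin, Fintype.card_subtype] at h
  exact h

theorem edges_subset (G : SimpleGraph (Fin p)) : edges G ⊆ potentialEdges p := by
  intro e he
  simp only [edges, Set.Finite.mem_toFinset] at he
  simpa [potentialEdges] using G.not_isDiag_of_mem_edgeSet he

theorem coe_edges (G : SimpleGraph (Fin p)) : (edges G : Set (Sym2 (Fin p))) = G.edgeSet := by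
  simp [edges]

theorem card_edges (G : SimpleGraph (Fin p)) : (edges G).card = G.edgeSet.ncard := by
  rw [← coe_edges, Set.ncard_coe_finset]

theorem editDist_eq_card (G G' : SimpleGraph (Fin p)) :
    editDist G G' = (symmDiff (edges G) (edges G')).card := by
  rw [editDist, ← coe_edges, ← coe_edges, ← Finset.coe_symmDiff, Set.ncard_coe_finset]

theorem edges_injective : Function.Injective (edges (p := p)) := by
  intro G G' h
  rw [← SimpleGraph.edgeSet_inj, ← coe_edges, h, coe_edges]

theorem exists_edges_eq {A : Finset (Sym2 (Fin p))} (hA : A ⊆ potentialEdges p) :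
    ∃ G : SimpleGraph (Fin p), edges G = A := by
  refine ⟨SimpleGraph.fromEdgeSet A, ?_⟩
  rw [← Finset.coe_inj, coe_edges, SimpleGraph.edgeSet_fromEdgeSet]
  ext e
  simp only [Set.mem_sdiff, Finset.mem_coe]
  refine ⟨fun h => h.1, fun h => ⟨h, ?_⟩⟩
  have := hA h
  simpa [potentialEdges] using this

theorem sum_edges_eq (f : Finset (Sym2 (Fin p)) → ℝ) :
    ∑ G : SimpleGraph (Fin p), f (edges G) = ∑ A ∈ (potentialEdges p).powerset, f A := by
  refine Finset.sum_bij (fun G _ => edges G) (fun G _ => Finset.mem_powerset.2 (edges_subset G))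
    (fun G _ G' _ h => edges_injective h) (fun A hA => ?_) fun _ _ => rfl
  obtain ⟨G, hG⟩ := exists_edges_eq (Finset.mem_powerset.1 hA)
  exact ⟨G, Finset.mem_univ _, hG⟩

instance (p : ℕ) : MeasurableSingletonClass (SimpleGraph (Fin p)) where
  measurableSet_singleton G := by
    rw [← SimpleGraph.measurableEmbedding_edgeSet.measurableSet_image, Set.image_singleton]
    exact measurableSet_singleton _

instance (p : ℕ) (c : ℝ) : IsProbabilityMeasure (erdosRenyi p c) := by
  unfold erdosRenyi; infer_instance

theorem erdosRenyi_real_singleton {c : ℝ} (h0 : 0 ≤ c / p) (h1 : c / p ≤ 1)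
    (G : SimpleGraph (Fin p)) :
    (erdosRenyi p c).real {G} = (c / p) ^ (edges G).card *
      (1 - c / p) ^ ((potentialEdges p).card - (edges G).card) := by
  rw [measureReal_def, erdosRenyi, SimpleGraph.binomialRandom_singleton,
    Set.projIcc_of_mem zero_le_one ⟨h0, h1⟩, card_edges, card_potentialEdges]
  simp

theorem sum_erdosRenyi_real_mul {c : ℝ} (h0 : 0 ≤ c / p) (h1 : c / p ≤ 1)
    (f : Finset (Sym2 (Fin p)) → ℝ) :
    ∑ G : SimpleGraph (Fin p), (erdosRenyi p c).real {G} * f (edges G) =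
      bernoulliSum (c / p) (potentialEdges p) f := by
  simp_rw [erdosRenyi_real_singleton h0 h1]
  exact sum_edges_eq fun A => (c / p) ^ A.card *
      (1 - c / p) ^ ((potentialEdges p).card - A.card) * f A

theorem card_editDist_le_le_exp {D : ℕ} (hp : 2 ≤ p) (hD : 1 ≤ D)
    (hβ : (D : ℝ) / (p.choose 2 : ℝ) ≤ 1 / 2) (g : SimpleGraph (Fin p)) :
    ∑ G : SimpleGraph (Fin p), (if editDist G g ≤ D then (1 : ℝ) else 0) ≤
      Real.exp (p.choose 2 * Real.binEntropy (D / p.choose 2)) := by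
  have hN := card_potentialEdges p
  have h := card_symmDiff_le_le_exp (edges_subset g) hD (by rwa [hN])
    (Finset.card_pos.1 (by rw [hN]; exact Nat.choose_pos hp))
  rw [hN] at h
  refine le_trans (le_of_eq ?_) h
  simp_rw [editDist_eq_card]
  rw [sum_edges_eq fun A => if (symmDiff A (edges g)).card ≤ D then (1 : ℝ) else 0]
  simp

end Graphs

/-! ### Error probability and change of measure -/

section Channel

variable {p n : ℕ}

instance (J : Matrix (Fin p) (Fin p) ℝ) : IsProbabilityMeasure (sampleLaw n J) := by
  unfold sampleLaw; infer_instance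

theorem errorProb_toReal (c : ℝ) (J : SimpleGraph (Fin p) → Matrix (Fin p) (Fin p) ℝ)
    {Ghat : (Fin n → EuclideanSpace ℝ (Fin p)) → SimpleGraph (Fin p)} (hG : Measurable Ghat)
    (D : ℕ) :
    (errorProb p n c J Ghat D).toReal = ∑ G : SimpleGraph (Fin p),
      (erdosRenyi p c).real {G} * (sampleLaw n (J G)).real {x | D < editDist G (Ghat x)} := by
  have hm : MeasurableSet {z : SimpleGraph (Fin p) × (Fin n → EuclideanSpace ℝ (Fin p)) |
      D < editDist z.1 (Ghat z.2)} := by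
    have h : Measurable fun z : SimpleGraph (Fin p) × (Fin n → EuclideanSpace ℝ (Fin p)) =>
        (z.1, Ghat z.2) := by fun_prop
    exact h (MeasurableSet.of_discrete (s := {y : SimpleGraph (Fin p) × SimpleGraph (Fin p) |
      D < editDist y.1 y.2}))
  rw [errorProb, jointLaw, Measure.finsetSum_apply, ENNReal.toReal_sum]
  · refine Finset.sum_congr rfl fun G _ => ?_
    rw [Measure.smul_apply, smul_eq_mul, ENNReal.toReal_mul, Measure.dirac_prod,
      Measure.map_apply (by fun_prop) hm]
    rfl
  · intro G _
    rw [Measure.smul_apply, smul_eq_mul]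
    exact ENNReal.mul_ne_top (measure_ne_top _ _) (measure_ne_top _ _)

theorem sum_erdosRenyi_real (c : ℝ) :
    ∑ G : SimpleGraph (Fin p), (erdosRenyi p c).real {G} = 1 := by
  simp

/-- Without samples, the error probability is bounded below as soon as the entropy of the graph
exceeds that of the permitted distortion. -/
theorem one_div_twelve_le_errorProb_of_no_samples {c : ℝ}
    (J : SimpleGraph (Fin p) → Matrix (Fin p) (Fin p) ℝ)
    {Ghat : (Fin n → EuclideanSpace ℝ (Fin p)) → SimpleGraph (Fin p)} (hG : Measurable Ghat)
    {D : ℕ} (hn : n = 0) (hp : 2 ≤ p) (hD : 1 ≤ D)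
    (h0 : (D : ℝ) / (p.choose 2 : ℝ) < c / p) (h1 : c / p < 1 - (D : ℝ) / (p.choose 2 : ℝ)) :
    1 / 12 ≤ (errorProb p n c J Ghat D).toReal := by
  classical
  subst hn
  set q := c / p with hq
  set β := (D : ℝ) / (p.choose 2 : ℝ) with hβ
  set g := Ghat fun i => i.elim0 with hg
  have hconst : ∀ x, Ghat x = g := fun x => by rw [hg]; congr 1; exact Subsingleton.elim _ _
  have hN0 : (0 : ℝ) < p.choose 2 := by exact_mod_cast Nat.choose_pos hp
  have hDβ : (D : ℝ) = p.choose 2 * β := by rw [hβ]; field_simp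
  have hD1 : (1 : ℝ) ≤ D := by exact_mod_cast hD
  have hβ0 : 0 < β := by rw [hβ]; exact div_pos (by linarith) hN0
  have hq0 : 0 ≤ q := by linarith
  have hq1 : q ≤ 1 := by linarith
  -- With these signs `signedCount` is the edit distance to `g` minus its mean. Each pair disagrees
  -- with probability `q` or `1 - q`, both above `β`, so the mean is at least `D`.
  set ε : Sym2 (Fin p) → ℝ := fun e => if e ∈ edges g then -1 else 1 with hε
  have hε2 : ∀ e, ε e ^ 2 = 1 := fun e => by simp only [hε]; split_ifs <;> norm_num
  have hcard := card_potentialEdges p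
  have hvar : 1 / 2 ≤ (potentialEdges p).card * (q * (1 - q)) := by
    rw [hcard]
    -- One of `q`, `1 - q` is at least `1/2` and the other exceeds `β`; `N β = D ≥ 1` then gives
    -- variance at least `1/2`.
    have : β * (1 / 2) ≤ q * (1 - q) := by
      rcases le_total q (1 / 2) with h | h <;> nlinarith
    nlinarith
  refine (one_div_twelve_le_bernoulliSum_pos hq0 hq1 hε2 hvar).trans ?_
  rw [errorProb_toReal c J hG, ← sum_erdosRenyi_real_mul hq0 hq1]
  refine Finset.sum_le_sum fun G _ => mul_le_mul_of_nonneg_left ?_ measureReal_nonneg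
  split_ifs with hpos
  · have hdist : D < editDist G g := by
      rw [editDist_eq_card]
      have hsub : symmDiff (edges G) (edges g) ⊆ potentialEdges p := by
        intro x hx
        rcases Finset.mem_symmDiff.1 hx with h | h
        exacts [edges_subset _ h.1, edges_subset _ h.1]
      have h2 : ((symmDiff (edges G) (edges g)).card : ℝ) =
          ∑ e ∈ potentialEdges p, if e ∈ symmDiff (edges G) (edges g) then 1 else 0 := by
        rw [Finset.sum_ite_mem, Finset.inter_eq_right.2 hsub]; simp
      have h3 : signedCount q ε (potentialEdges p) (edges G) + (potentialEdges p).card * β ≤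
          ((symmDiff (edges G) (edges g)).card : ℝ) := by
        rw [h2, signedCount, ← nsmul_eq_mul, ← Finset.sum_const, ← Finset.sum_add_distrib]
        refine Finset.sum_le_sum fun e _ => ?_
        simp only [hε, Finset.mem_symmDiff]
        by_cases ha : e ∈ edges G <;> by_cases hb : e ∈ edges g <;> simp [ha, hb] <;> linarith
      rw [hcard, ← hDβ] at h3
      exact_mod_cast (by linarith : (D : ℝ) < (symmDiff (edges G) (edges g)).card)
    have : {x | D < editDist G (Ghat x)} = Set.univ := by
      ext x; simp [hconst, hdist]
    rw [this, probReal_univ]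
  · exact measureReal_nonneg

/-- The reference measure for the change of measure: independent samples with independent
components of variance `σ ^ 2`. -/
noncomputable def referenceLaw (p n : ℕ) (σ : ℝ) : Measure (Fin n → EuclideanSpace ℝ (Fin p)) :=
  Measure.pi fun _ => (stdGaussian (EuclideanSpace ℝ (Fin p))).map fun x => σ • x

instance (σ : ℝ) : IsProbabilityMeasure
    ((stdGaussian (EuclideanSpace ℝ (Fin p))).map fun x => σ • x) :=
  Measure.isProbabilityMeasure_map (by fun_prop)

instance (σ : ℝ) : IsProbabilityMeasure (referenceLaw p n σ) := by
  unfold referenceLaw; infer_instance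

theorem sampleLaw_real_le {α : ℝ} (hα : α < 1) {J : Matrix (Fin p) (Fin p) ℝ}
    (hJ : J.PosDef) (hw : WalkSummable α J) (hd : ∀ i, J i i = 1)
    (S : Set (Fin n → EuclideanSpace ℝ (Fin p))) :
    (sampleLaw n J).real S ≤
      (√(1 - α)⁻¹ ^ p) ^ n * (referenceLaw p n √(1 - α)⁻¹).real S := by
  have h := pi_le_smul_pi (ι := Fin n) _ _ _ ENNReal.ofReal_ne_top
    (multivariateGaussian_le hα hJ hw hd) S
  rw [Fintype.card_fin, Measure.smul_apply, smul_eq_mul] at h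
  have h2 := ENNReal.toReal_mono (ENNReal.mul_ne_top
    (ENNReal.pow_ne_top ENNReal.ofReal_ne_top) (measure_ne_top _ _)) h
  rwa [ENNReal.toReal_mul, ENNReal.toReal_pow, ENNReal.toReal_ofReal (by positivity)] at h2

/-- Since `Q` does not depend on `G`, the sums can be exchanged: every value of the estimate is
within `D` of at most a ball's worth of graphs. -/
theorem sum_real_editDist_le (Q : Measure (Fin n → EuclideanSpace ℝ (Fin p)))
    [IsProbabilityMeasure Q]
    {Ghat : (Fin n → EuclideanSpace ℝ (Fin p)) → SimpleGraph (Fin p)} (hG : Measurable Ghat)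
    {D : ℕ} (hp : 2 ≤ p) (hD : 1 ≤ D) (hβ : (D : ℝ) / (p.choose 2 : ℝ) ≤ 1 / 2) :
    ∑ G : SimpleGraph (Fin p), Q.real {x | editDist G (Ghat x) ≤ D} ≤
      Real.exp (p.choose 2 * Real.binEntropy (D / p.choose 2)) := by
  have : IsProbabilityMeasure (Q.map Ghat) := Measure.isProbabilityMeasure_map hG.aemeasurable
  have h1 : ∀ G : SimpleGraph (Fin p), Q.real {x | editDist G (Ghat x) ≤ D} =
      ∑ g : SimpleGraph (Fin p), (Q.map Ghat).real {g} * if editDist G g ≤ D then 1 else 0 := by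
    intro G
    have h2 : Q.real {x | editDist G (Ghat x) ≤ D} =
        (Q.map Ghat).real {g | editDist G g ≤ D} := by
      rw [map_measureReal_apply hG MeasurableSet.of_discrete]; rfl
    have h3 := sum_measureReal_singleton (μ := Q.map Ghat)
      (Finset.univ.filter fun g => editDist G g ≤ D)
    rw [h2]
    simp only [mul_ite, mul_one, mul_zero]
    rw [← Finset.sum_filter, h3]
    simp
  simp_rw [h1]
  rw [Finset.sum_comm]
  have h4 : ∑ g : SimpleGraph (Fin p), (Q.map Ghat).real {g} = 1 := by
    simp
  calc _ ≤ ∑ g : SimpleGraph (Fin p), (Q.map Ghat).real {g} *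
        Real.exp (p.choose 2 * Real.binEntropy (D / p.choose 2)) := by
        refine Finset.sum_le_sum fun g _ => ?_
        rw [← Finset.mul_sum]
        exact mul_le_mul_of_nonneg_left (card_editDist_le_le_exp hp hD hβ g) measureReal_nonneg
    _ = _ := by rw [← Finset.sum_mul, h4, one_mul]

/-- The probability of a graph in terms of the deviation of its number of edges. -/
theorem erdosRenyi_real_singleton_eq_exp {c : ℝ} (h0 : 0 < c / p) (h1 : c / p < 1)
    (G : SimpleGraph (Fin p)) :
    (erdosRenyi p c).real {G} = Real.exp (-(p.choose 2 * Real.binEntropy (c / p)) -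
      signedCount (c / p) (fun _ => 1) (potentialEdges p) (edges G) *
        Real.log ((1 - c / p) / (c / p))) := by
  rw [erdosRenyi_real_singleton h0.le h1.le]
  set q := c / p with hq
  have h1' : 0 < 1 - q := by linarith
  have hle := Finset.card_le_card (edges_subset G)
  have hs : signedCount q (fun _ => 1) (potentialEdges p) (edges G) =
      (edges G).card - (potentialEdges p).card * q := by
    simp only [signedCount, one_mul, Finset.sum_sub_distrib, Finset.sum_ite_mem,
      Finset.inter_eq_right.2 (edges_subset G), Finset.sum_const, nsmul_eq_mul, mul_one]
  have hpos : 0 < q ^ (edges G).card * (1 - q) ^ ((potentialEdges p).card - (edges G).card) :=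
    mul_pos (pow_pos h0 _) (pow_pos h1' _)
  rw [← Real.exp_log hpos, Real.log_mul (pow_pos h0 _).ne' (pow_pos h1' _).ne', Real.log_pow,
    Real.log_pow, Nat.cast_sub hle, hs, ← card_potentialEdges, Real.log_div h1'.ne' h0.ne',
    Real.binEntropy, Real.log_inv, Real.log_inv]
  congr 1
  ring

/-- The converse inequality at a fixed number of vertices. -/
theorem one_le_errorProb_add {α c s : ℝ} (hα : α < 1) (hs : 0 < s)
    (J : SimpleGraph (Fin p) → Matrix (Fin p) (Fin p) ℝ) (hJ : ∀ G, IsPotentialMatrix G (J G))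
    {Ghat : (Fin n → EuclideanSpace ℝ (Fin p)) → SimpleGraph (Fin p)} (hG : Measurable Ghat)
    {D : ℕ} (hp : 2 ≤ p) (hD : 1 ≤ D) (hβ : (D : ℝ) / (p.choose 2 : ℝ) ≤ 1 / 2)
    (h0 : 0 < c / p) (h1 : c / p < 1) :
    1 ≤ (erdosRenyi p c).real {G | (∀ i, J G i i = 1) ∧ WalkSummable α (J G)}ᶜ +
      (errorProb p n c J Ghat D).toReal + p.choose 2 / s ^ 2 +
      Real.exp (-(p.choose 2 * Real.binEntropy (c / p)) + s) * (√(1 - α)⁻¹ ^ p) ^ n *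
        Real.exp (p.choose 2 * Real.binEntropy (D / p.choose 2)) := by
  classical
  set q := c / p with hq
  set A : Set (SimpleGraph (Fin p)) := {G | (∀ i, J G i i = 1) ∧ WalkSummable α (J G)} with hA
  set L := Real.log ((1 - q) / q) with hL
  set σ := √(1 - α)⁻¹ with hσ
  set Q := referenceLaw p n σ with hQ
  set W := Real.exp (-(p.choose 2 * Real.binEntropy q) + s) * (σ ^ p) ^ n with hW
  have hW0 : 0 ≤ W := by positivity
  have hA' : (erdosRenyi p c).real Aᶜ =
      ∑ G : SimpleGraph (Fin p), (erdosRenyi p c).real {G} * if G ∈ Aᶜ then 1 else 0 := by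
    have h3 := sum_measureReal_singleton (μ := erdosRenyi p c)
      (Finset.univ.filter fun G => G ∈ Aᶜ)
    simp only [mul_ite, mul_one, mul_zero]
    rw [← Finset.sum_filter, h3, Finset.coe_filter_univ]
    rfl
  have htyp : ∑ G : SimpleGraph (Fin p), (erdosRenyi p c).real {G} *
      (if s ^ 2 < (signedCount q (fun _ => 1) (potentialEdges p) (edges G) * L) ^ 2
        then 1 else 0) ≤ p.choose 2 / s ^ 2 := by
    rw [sum_erdosRenyi_real_mul h0.le h1.le fun B =>
      if s ^ 2 < (signedCount q (fun _ => 1) (potentialEdges p) B * L) ^ 2 then 1 else 0]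
    have hN : (0 : ℝ) ≤ p.choose 2 := by positivity
    -- For `L = 0` (that is, `q = 1/2`) all graphs are equally likely and the atypical event is
    -- empty.
    rcases eq_or_ne L 0 with hL0 | hL0
    · simp only [hL0, mul_zero, ne_eq, OfNat.ofNat_ne_zero, not_false_eq_true, zero_pow]
      rw [bernoulliSum_congr (g := fun _ => 0 * 1), bernoulliSum_const_mul]
      · rw [zero_mul]; positivity
      · intro B _; rw [if_neg (not_lt.2 (sq_nonneg s))]; simp
    · have hL2 : 0 < L ^ 2 := by positivity
      calc _ = bernoulliSum q (potentialEdges p) (fun B => if s ^ 2 / L ^ 2 <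
              signedCount q (fun _ => 1) (potentialEdges p) B ^ 2 then 1 else 0) := by
            refine bernoulliSum_congr fun B _ => if_congr ?_ rfl rfl
            rw [div_lt_iff₀ hL2, mul_pow]
        _ ≤ (potentialEdges p).card * (q * (1 - q)) / (s ^ 2 / L ^ 2) :=
            bernoulliSum_lt_sq_le h0.le h1.le (fun _ => one_pow 2) _ (by positivity)
        _ = p.choose 2 * (q * (1 - q) * L ^ 2) / s ^ 2 := by
            rw [card_potentialEdges]; field_simp
        _ ≤ _ := by
            gcongr
            exact mul_le_of_le_one_right hN (mul_log_sq_le_one h0 h1)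
  have hball : ∑ G : SimpleGraph (Fin p), W * Q.real {x | editDist G (Ghat x) ≤ D} ≤
      W * Real.exp (p.choose 2 * Real.binEntropy (D / p.choose 2)) := by
    rw [← Finset.mul_sum]
    exact mul_le_mul_of_nonneg_left (sum_real_editDist_le Q hG hp hD hβ) hW0
  refine le_trans ?_ (add_le_add (add_le_add le_rfl htyp) hball)
  rw [hA', errorProb_toReal c J hG, ← Finset.sum_add_distrib, ← Finset.sum_add_distrib,
    ← Finset.sum_add_distrib]
  refine (sum_erdosRenyi_real (p := p) c).symm.le.trans ?_
  refine Finset.sum_le_sum fun G _ => ?_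
  set w := (erdosRenyi p c).real {G} with hw
  have hw0 : 0 ≤ w := measureReal_nonneg
  have herr0 : 0 ≤ w * (sampleLaw n (J G)).real {x | D < editDist G (Ghat x)} := by positivity
  have hQ0 : 0 ≤ W * Q.real {x | editDist G (Ghat x) ≤ D} := by positivity
  -- The mass of `G` is charged to one of three sources: a bad model, an atypical edge count, or
  -- else error plus success, where success is controlled by `Q`.
  by_cases hGA : G ∈ A
  swap
  · have : G ∈ Aᶜ := hGA
    rw [if_pos this]
    split_ifs <;> linarith
  rw [if_neg (fun h : G ∈ Aᶜ => h hGA)]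
  split_ifs with ht
  · linarith
  have hZ : -s ≤ signedCount q (fun _ => 1) (potentialEdges p) (edges G) * L :=
    (abs_le_of_sq_le_sq' (not_lt.1 ht) hs.le).1
  have hwle : w ≤ Real.exp (-(p.choose 2 * Real.binEntropy q) + s) := by
    rw [hw, erdosRenyi_real_singleton_eq_exp h0 h1, ← hq, ← hL]
    exact Real.exp_le_exp.2 (by linarith)
  have hcompl : (sampleLaw n (J G)).real {x | D < editDist G (Ghat x)} =
      1 - (sampleLaw n (J G)).real {x | editDist G (Ghat x) ≤ D} := by
    have hm : MeasurableSet {x | editDist G (Ghat x) ≤ D} :=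
      hG (MeasurableSet.of_discrete (s := {g : SimpleGraph (Fin p) | editDist G g ≤ D}))
    rw [← probReal_compl_eq_one_sub hm]
    congr 1
    ext x
    simp
  have hok := sampleLaw_real_le (n := n) hα (hJ G).1 hGA.2 hGA.1 {x | editDist G (Ghat x) ≤ D}
  have hprod : w * (sampleLaw n (J G)).real {x | editDist G (Ghat x) ≤ D} ≤
      W * Q.real {x | editDist G (Ghat x) ≤ D} := by
    rw [hW, mul_assoc]
    exact mul_le_mul hwle hok measureReal_nonneg (Real.exp_pos _).le
  rw [hcompl]
  linarith

end Channel

end GGMConverse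

/-! ### Numerical constants and the conclusion -/

namespace GGMConverse

/-- From `log 2 + log π + 1 > 2.6`. The surplus, multiplied by `n p / 2`, is `1.3 n p`, enough to
beat the deviation `s = 1.2 p` once `n ≥ 1`. -/
theorem log_inv_add_le_log {α : ℝ} (hα : α < 1) :
    Real.log (1 - α)⁻¹ + 2.6 ≤
      Real.log (2 * Real.pi * Real.exp 1 * (1 / (1 - α) + 1)) := by
  have hα' : 0 < 1 - α := by linarith
  have hpi := Real.pi_pos
  have h1 : Real.log (2 * Real.pi * Real.exp 1 * (1 - α)⁻¹) =
      Real.log 2 + Real.log Real.pi + 1 + Real.log (1 - α)⁻¹ := by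
    rw [Real.log_mul (by positivity) (by positivity), Real.log_mul (by positivity) (by positivity),
      Real.log_mul (by positivity) (by positivity), Real.log_exp]
  have h2 : 1 ≤ Real.log Real.pi := by
    rw [Real.le_log_iff_exp_le hpi]
    linarith [Real.exp_one_lt_d9, Real.pi_gt_d2]
  have h3 : Real.log (2 * Real.pi * Real.exp 1 * (1 - α)⁻¹) ≤
      Real.log (2 * Real.pi * Real.exp 1 * (1 / (1 - α) + 1)) := by
    apply Real.log_le_log (by positivity)
    gcongr
    rw [one_div]
    linarith
  linarith [Real.log_two_gt_d9]

/-- Entropy increases on `[0, 1/2]` and is symmetric about `1/2`. -/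
theorem lt_and_lt_of_binEntropy_lt {β q : ℝ} (hβ0 : 0 ≤ β) (hβ : β ≤ 1 / 2) (hq0 : 0 ≤ q)
    (hq1 : q ≤ 1) (h : Real.binEntropy β < Real.binEntropy q) : β < q ∧ q < 1 - β := by
  have hmono := Real.binEntropy_strictMonoOn.monotoneOn
  rw [one_div] at hβ
  refine ⟨not_le.1 fun hle => h.not_ge ?_, not_le.1 fun hle => h.not_ge ?_⟩
  · exact hmono ⟨hq0, hle.trans hβ⟩ ⟨hβ0, hβ⟩ hle
  · rw [← Real.binEntropy_one_sub q]
    exact hmono ⟨by linarith, by linarith⟩ ⟨hβ0, hβ⟩ (by linarith)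

/-- The converse at a fixed number of vertices, with explicit smallness conditions. -/
theorem le_of_errorProb_lt {p n D : ℕ} {α c : ℝ} (hα : α < 1) (hp : 20 ≤ p)
    (hc : 0 ≤ c ∧ c ≤ p) (J : SimpleGraph (Fin p) → Matrix (Fin p) (Fin p) ℝ)
    (hJ : ∀ G, IsPotentialMatrix G (J G))
    (hwalk : (erdosRenyi p c).real {G | (∀ i, J G i i = 1) ∧ WalkSummable α (J G)}ᶜ < 1 / 20)
    (hD : 1 ≤ D) (hβ : (D : ℝ) / (p.choose 2 : ℝ) ≤ 1 / 2)
    {Ghat : (Fin n → EuclideanSpace ℝ (Fin p)) → SimpleGraph (Fin p)} (hG : Measurable Ghat)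
    (herr : (errorProb p n c J Ghat D).toReal < 1 / 20) :
    (n : ℝ) ≥ 2 / (p * Real.logb 2 (2 * Real.pi * Real.exp 1 * (1 / (1 - α) + 1)))
      * (p.choose 2 : ℝ)
      * (binEntropyBits (c / p) - binEntropyBits ((D : ℝ) / (p.choose 2 : ℝ))) := by
  by_contra! hlt
  have hp0 : (20 : ℝ) ≤ p := by exact_mod_cast hp
  have hα' : 0 < 1 - α := by linarith
  set C := Real.log (2 * Real.pi * Real.exp 1 * (1 / (1 - α) + 1)) with hC
  have hC0 : 0 < C := by
    refine Real.log_pos ?_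
    have h1 : 1 < Real.exp 1 := Real.one_lt_exp_iff.2 one_pos
    have h2 : 0 < 1 / (1 - α) := by positivity
    have h3 : 1 < 2 * Real.pi := by linarith [Real.pi_gt_three]
    calc (1 : ℝ) < 2 * Real.pi * Real.exp 1 := one_lt_mul_of_lt_of_le h3 h1.le
      _ ≤ _ := le_mul_of_one_le_right (by positivity) (by linarith)
  have hCl := log_inv_add_le_log hα
  rw [← hC] at hCl
  have hN0 : (0 : ℝ) < p.choose 2 := by exact_mod_cast Nat.choose_pos (by omega)
  have hNp : (p.choose 2 : ℝ) ≤ p ^ 2 / 2 := by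
    rw [Nat.cast_choose_two]; nlinarith
  set N : ℝ := (p.choose 2 : ℝ) with hN
  set β := (D : ℝ) / N with hβd
  set q := c / p with hq
  have hβ0 : 0 < β := div_pos (by exact_mod_cast hD) hN0
  have hq0 : 0 ≤ q := div_nonneg hc.1 (by linarith)
  have hq1 : q ≤ 1 := div_le_one_of_le₀ hc.2 (by linarith)
  have hlog2 : 0 < Real.log 2 := Real.log_pos one_lt_two
  have hmain : n * p * C / 2 < N * (Real.binEntropy q - Real.binEntropy β) := by
    have : 2 / (p * Real.logb 2 (2 * Real.pi * Real.exp 1 * (1 / (1 - α) + 1))) * N *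
        (binEntropyBits q - binEntropyBits β) =
        2 * (N * (Real.binEntropy q - Real.binEntropy β)) / (p * C) := by
      rw [Real.logb, ← hC, binEntropyBits, binEntropyBits]
      field_simp
    rw [this, lt_div_iff₀ (by positivity)] at hlt
    linarith
  have hent : Real.binEntropy β < Real.binEntropy q := by
    have h1 : 0 < N * (Real.binEntropy q - Real.binEntropy β) :=
      lt_of_le_of_lt (by positivity) hmain
    linarith [pos_of_mul_pos_right h1 hN0.le]
  obtain ⟨hβq, hqβ⟩ := lt_and_lt_of_binEntropy_lt hβ0.le hβ hq0 hq1 hent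
  rcases Nat.eq_zero_or_pos n with hn | hn
  · linarith [one_div_twelve_le_errorProb_of_no_samples J hG hn (by omega) hD hβq hqβ]
  have hn1 : (1 : ℝ) ≤ n := by exact_mod_cast hn
  have hkey := one_le_errorProb_add (s := 1.2 * p) hα (by positivity) J hJ hG (by omega) hD hβ
    (hβ0.trans hβq) (by linarith)
  have hcheb : N / (1.2 * p) ^ 2 ≤ 0.348 := by
    rw [div_le_iff₀ (by positivity)]
    nlinarith
  have hpow : (√(1 - α)⁻¹ ^ p) ^ n = Real.exp (n * p / 2 * Real.log (1 - α)⁻¹) := by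
    rw [← Real.exp_log (by positivity : 0 < (√(1 - α)⁻¹ ^ p) ^ n), Real.log_pow, Real.log_pow,
      Real.log_sqrt (by positivity)]
    congr 1
    ring
  have hexp : Real.exp (-(N * Real.binEntropy q) + 1.2 * p) * (√(1 - α)⁻¹ ^ p) ^ n *
      Real.exp (N * Real.binEntropy β) ≤ 1 / 2 := by
    rw [hpow, ← Real.exp_add, ← Real.exp_add]
    -- The exponent is at most `1.2 p - 1.3 n p ≤ -0.1 p`, and `p ≥ 20`.
    calc _ ≤ Real.exp (-1) := by
          refine Real.exp_le_exp.2 ?_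
          have h1 : n * p / 2 * Real.log (1 - α)⁻¹ ≤ n * p / 2 * (C - 2.6) := by
            gcongr
            linarith
          have h2 : (p : ℝ) ≤ n * p := by nlinarith
          nlinarith
      _ ≤ 1 / 2 := by
          rw [Real.exp_neg, one_div]
          exact inv_anti₀ two_pos (by linarith [Real.add_one_le_exp (1 : ℝ)])
  -- The four terms total less than `1/20 + 1/20 + 0.348 + 1/2 < 1`.
  linarith

end GGMConverse

theorem corollary1
    -- the walk-summability parameter, and the average degree (constant, or a function of `p`)
    (α : ℝ) (hα : α < 1)
    (c : ℕ → ℝ) (hc : ∀ᶠ p : ℕ in atTop, 0 ≤ c p ∧ c p ≤ p)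
    -- a Gaussian graphical model on every graph
    (J : ∀ p : ℕ, SimpleGraph (Fin p) → Matrix (Fin p) (Fin p) ℝ)
    (hJ : ∀ p G, GGMConverse.IsPotentialMatrix G (J p G))
    -- almost every model is normalized and `α`-walk-summable
    (hwalk : Tendsto
      (fun p : ℕ => GGMConverse.erdosRenyi p (c p)
        {G | (∀ i, J p G i i = 1) ∧ GGMConverse.WalkSummable α (J p G)})
      atTop (𝓝 1))
    -- the sample size and the permitted distortion, with `1 ≤ D` and `β ≤ 1 / 2`
    (n D : ℕ → ℕ)
    (hD : ∀ᶠ p : ℕ in atTop, 1 ≤ D p ∧ (D p : ℝ) / (p.choose 2 : ℝ) ≤ 1 / 2)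
    -- the estimators
    (Ghat : ∀ p : ℕ, (Fin (n p) → EuclideanSpace ℝ (Fin p)) → SimpleGraph (Fin p))
    (hGhat : ∀ p, Measurable (Ghat p))
    -- the probability of error vanishes
    (herr : Tendsto
      (fun p : ℕ => GGMConverse.errorProb p (n p) (c p) (J p) (Ghat p) (D p))
      atTop (𝓝 0)) :
    ∀ᶠ p : ℕ in atTop,
      (n p : ℝ) ≥
        2 / (p * Real.logb 2 (2 * Real.pi * Real.exp 1 * (1 / (1 - α) + 1)))
          * (p.choose 2 : ℝ)
          * (GGMConverse.binEntropyBits (c p / p)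
              - GGMConverse.binEntropyBits ((D p : ℝ) / (p.choose 2 : ℝ))) := by
  have hw := (ENNReal.tendsto_toReal ENNReal.one_ne_top).comp hwalk
  have he := (ENNReal.tendsto_toReal ENNReal.zero_ne_top).comp herr
  rw [ENNReal.toReal_one] at hw
  rw [ENNReal.toReal_zero] at he
  filter_upwards [hc, hD, eventually_ge_atTop 20,
    hw.eventually (lt_mem_nhds (by norm_num : (19 / 20 : ℝ) < 1)),
    he.eventually (gt_mem_nhds (by norm_num : (0 : ℝ) < 1 / 20))] with p hcp hDp hp hwp hep
  refine GGMConverse.le_of_errorProb_lt hα hp hcp (J p) (hJ p) ?_ hDp.1 hDp.2 (hGhat p) hep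
  rw [probReal_compl_eq_one_sub (Set.toFinite _).measurableSet, measureReal_def]
  simp only [Function.comp_apply] at hwp
  linarith
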